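/- **Setting.** Let $\Omega\subseteq\mathbb R^2$ be open and connected, $(x_0,t_0)\in\Omega$, and let $(q,r)$ be a smooth complex solution on $\Omega$ of the coupled DNLSII equations $$ iq_t+q_{xx}+iqrq_x=0,\qquad ir_t-r_{xx}+irqr_x=0 .$$ Its Lax pair is $\Phi_x=U\Phi$, $\Phi_t=V\Phi$ with $$U=\left(-i\lambda^2+\tfrac i4qr\right)J+\lambda Q,\qquad V=\left(-2i\lambda^4+iqr\lambda^2+\tfrac14(qr_x-rq_x)-\tfrac i8q^2r^2\right)J+2\lambda^3Q+\lambda W,$$ $$J=\begin{pmatrix}1&0\\0&-1\end{pmatrix},\quad Q=\begin{pmatrix}0&q\\-r&0\end{pmatrix},\quad W=\begin{pmatrix}0&iq_x-\frac12q^2r\\ ir_x+\frac12r^2q&0\end{pmatrix}.$$ Let $n\ge1$, let $\lambda_1,\dots,\lambda_n$ be distinct nonzero complex numbers, and let $\Phi_j=(f_j,g_j)^T$ be smooth solutions on $\Omega$ of the Lax pair with $\lambda=\lambda_j$. An *integral* of $(q,r)$ is a smooth nowhere vanishing function $H=\exp\int\left(\frac i2qr\,dx-\frac14(iq^2r^2-2qr_x+2rq_x)\,dt\right)$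 on $\Omega$, i.e. a nowhere vanishing function with $H_x=\frac i2Hqr$ and $H_t=-\frac14H(iq^2r^2-2qr_x+2rq_x)$. Such an $H$ is determined up to a constant factor. *Iteration.* Start from $q^{[0]}=q$, $r^{[0]}=r$, $\Phi_j^{[0]}=\Phi_j$. For $k=0,\dots,n-1$ suppose that $f^{[k]}_{k+1}$ and $g^{[k]}_{k+1}$ do not vanish on $\Omega$, put $h_{k+1}^{[k]}=f_{k+1}^{[k]}/g_{k+1}^{[k]}$, let $H^{[k]}$ be an integral of $(q^{[k]},r^{[k]})$, with $H=H^{[0]}$, choose smooth branches of $\sqrt{H^{[k]}}$ and $\sqrt{h^{[k]}_{k+1}}$ on $\Omega$, and set $$T_1^{[k]}(\lambda)=\begin{pmatrix}\sqrt{H^{[k]}}&\\&\frac1{\sqrt{H^{[k]}}}\end{pmatrix}\begin{pmatrix}\frac{\lambda}{\sqrt{h_{k+1}^{[k]}}}&-\lambda_{k+1}\sqrt{h_{k+1}^{[k]}}\\-\frac{\lambda_{k+1}}{\sqrt{h_{k+1}^{[k]}}}&\lambda\sqrt{h_{k+1}^{[k]}}\end{pmatrix},\qquad \Phi_j^{[k+1]}=T_1^{[k]}(\lambda_j)\Phi_j^{[k]},$$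 $$q^{[k+1]}=\frac{H^{[k]}}{h_{k+1}^{[k]}}\left(q^{[k]}-2i\lambda_{k+1}h_{k+1}^{[k]}\right),\qquad r^{[k+1]}=\frac{h_{k+1}^{[k]}}{H^{[k]}}\left(r^{[k]}-\frac{2i\lambda_{k+1}}{h_{k+1}^{[k]}}\right).$$ The constant factors of $H^{[1]},\dots,H^{[n-1]}$ are fixed by $H^{[k+1]}=h_{k+1}^{[k]}$ at the point $(x_0,t_0)$. Let $T_n=T_1^{[n-1]}\cdots T_1^{[1]}T_1^{[0]}$. *Determinants.* Let $W_n$ be the $n\times n$ matrix with $j$-th row $(\lambda_j^{n-1}f_j,\lambda_j^{n-2}g_j,\lambda_j^{n-3}f_j,\lambda_j^{n-4}g_j,\dots)$, ending in $\lambda_j^0$, and let $\widehat W_n$ be $W_n$ with all $f_j$ and $g_j$ exchanged. Let $\xi_n=(\lambda^{n-1},0,\lambda^{n-3},0,\dots)$ and $\widehat\xi_n=(0,\lambda^{n-2},0,\lambda^{n-4},\dots)$, both of length $n$, and let $\eta_n=(\lambda_j^ng_j)_{j=1}^n$ and $\widehat\eta_n=(\lambda_j^nf_j)_{j=1}^n$,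 as columns. Put $$\widehat T_n=\begin{pmatrix}\begin{vmatrix}\lambda^n&\widehat\xi_n\\ \widehat\eta_n&\widehat W_n\end{vmatrix}&\begin{vmatrix}0&\xi_n\\ \widehat\eta_n&\widehat W_n\end{vmatrix}\\[3ex]\begin{vmatrix}0&\xi_n\\ \eta_n&W_n\end{vmatrix}&\begin{vmatrix}\lambda^n&\widehat\xi_n\\ \eta_n&W_n\end{vmatrix}\end{pmatrix}.$$ **Theorem.** (1) $T_n$ is an $n$-fold Darboux transformation: $(q^{[n]},r^{[n]})$ is a smooth solution of the coupled DNLSII equations on $\Omega$, and for all $\lambda\in\mathbb C$, $T_{n,x}+T_nU=U^{[n]}T_n$ and $T_{n,t}+T_nV=V^{[n]}T_n$, where $U^{[n]},V^{[n]}$ are $U,V$ with $(q,r)$ replaced by $(q^{[n]},r^{[n]})$. (2) The integrals $H^{[k]}$, $k\ge1$, are eliminated: $H^{[k+1]}=h_{k+1}^{[k]}$ on all of $\Omega$ for $0\le k\le n-2$, and $h_n^{[n-1]}$ is an integral of $(q^{[n]},r^{[n]})$. (3) $|W_n|$ and $|\widehat W_n|$ vanish nowhere on $\Omega$, and, for a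 suitable smooth branch on $\Omega$ of $\sqrt{|W_n||\widehat W_n|}$ and the chosen branch of $\sqrt H$, for all $\lambda\in\mathbb C$ and on all of $\Omega$, $$T_n=\frac1{\sqrt{|W_n||\widehat W_n|}}\,\widehat T_n\ \ (n\text{ even}),\qquad T_n=\frac1{\sqrt{|W_n||\widehat W_n|}}\begin{pmatrix}\sqrt H&\\&\frac1{\sqrt H}\end{pmatrix}\widehat T_n\ \ (n\text{ odd}).$$ -/

import Mathlib

noncomputable section

namespace CoupledDNLSII

open Complex Matrix
open scoped ContDiff

/-- Partial derivative in the first variable `x` of a function of `(x, t)`. -/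
def dx (u : ℝ × ℝ → ℂ) (p : ℝ × ℝ) : ℂ := deriv (fun y : ℝ => u (y, p.2)) p.1

/-- Partial derivative in the second variable `t` of a function of `(x, t)`. -/
def dt (u : ℝ × ℝ → ℂ) (p : ℝ × ℝ) : ℂ := deriv (fun y : ℝ => u (p.1, y)) p.2

/-- `u` is a smooth complex function on the region `Ω` of the `(x, t)`-plane. -/
def SmoothOn (Ω : Set (ℝ × ℝ)) (u : ℝ × ℝ → ℂ) : Prop := ContDiffOn ℝ ∞ u Ω

/-- `(q, r)` is a smooth solution on `Ω` of the coupled DNLSII equations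
`i q_t + q_xx + i q r q_x = 0`, `i r_t - r_xx + i r q r_x = 0`. -/
structure IsSolution (Ω : Set (ℝ × ℝ)) (q r : ℝ × ℝ → ℂ) : Prop where
  smooth_q : SmoothOn Ω q
  smooth_r : SmoothOn Ω r
  eq_q : ∀ p ∈ Ω, I * dt q p + dx (dx q) p + I * q p * r p * dx q p = 0
  eq_r : ∀ p ∈ Ω, I * dt r p - dx (dx r) p + I * r p * q p * dx r p = 0

/-- The constant matrix `J` of the Lax pair. -/
def laxJ : Matrix (Fin 2) (Fin 2) ℂ := !![1, 0; 0, -1]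

/-- The matrix `Q` of the Lax pair. -/
def laxQ (q r : ℝ × ℝ → ℂ) (p : ℝ × ℝ) : Matrix (Fin 2) (Fin 2) ℂ :=
  !![0, q p; -r p, 0]

/-- The matrix `W` of the Lax pair. -/
def laxW (q r : ℝ × ℝ → ℂ) (p : ℝ × ℝ) : Matrix (Fin 2) (Fin 2) ℂ :=
  !![0, I * dx q p - 1 / 2 * q p ^ 2 * r p; I * dx r p + 1 / 2 * r p ^ 2 * q p, 0]

/-- The matrix `U` of the spatial part `Φ_x = U Φ` of the Lax pair (spectral parameter `z`). -/
def laxU (q r : ℝ × ℝ → ℂ) (z : ℂ) (p : ℝ × ℝ) : Matrix (Fin 2) (Fin 2) ℂ :=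
  (-I * z ^ 2 + I / 4 * q p * r p) • laxJ + z • laxQ q r p

/-- The matrix `V` of the temporal part `Φ_t = V Φ` of the Lax pair (spectral parameter `z`). -/
def laxV (q r : ℝ × ℝ → ℂ) (z : ℂ) (p : ℝ × ℝ) : Matrix (Fin 2) (Fin 2) ℂ :=
  (-2 * I * z ^ 4 + I * q p * r p * z ^ 2 + 1 / 4 * (q p * dx r p - r p * dx q p)
      - I / 8 * q p ^ 2 * r p ^ 2) • laxJ
    + (2 * z ^ 3) • laxQ q r p + z • laxW q r p

/-- `(f, g)` is a smooth eigenfunction on `Ω` of the Lax pair with potentials `(q, r)`,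
for the eigenvalue `z`. -/
structure IsEigenfunction (Ω : Set (ℝ × ℝ)) (q r : ℝ × ℝ → ℂ) (z : ℂ)
    (f g : ℝ × ℝ → ℂ) : Prop where
  smooth_f : SmoothOn Ω f
  smooth_g : SmoothOn Ω g
  eq_x : ∀ p ∈ Ω, ![dx f p, dx g p] = laxU q r z p *ᵥ ![f p, g p]
  eq_t : ∀ p ∈ Ω, ![dt f p, dt g p] = laxV q r z p *ᵥ ![f p, g p]

/-- `H` is a nonvanishing exponential
`exp (∫ (i/2) q r dx - (1/4) (i q² r² - 2 q r_x + 2 r q_x) dt)`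
of a primitive of the conservation law attached to `(q, r)`; the multiplicative constant
(the base point of the line integral) is left free. -/
structure IsIntegral (Ω : Set (ℝ × ℝ)) (q r H : ℝ × ℝ → ℂ) : Prop where
  smooth : SmoothOn Ω H
  ne_zero : ∀ p ∈ Ω, H p ≠ 0
  eq_x : ∀ p ∈ Ω, dx H p = 1 / 2 * I * H p * q p * r p
  eq_t : ∀ p ∈ Ω, dt H p =
    -(1 / 4) * H p * (I * q p ^ 2 * r p ^ 2 - 2 * q p * dx r p + 2 * r p * dx q p)

/-- `T (z; x, t)` is a Darboux matrix on `Ω` from the potentials `(q, r)` to `(q', r')`: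
`T_x + T U = U' T` and `T_t + T V = V' T` for every value `z` of the spectral parameter. -/
structure IsDarbouxMatrix (Ω : Set (ℝ × ℝ)) (q r q' r' : ℝ × ℝ → ℂ)
    (T : ℂ → ℝ × ℝ → Matrix (Fin 2) (Fin 2) ℂ) : Prop where
  smooth : ∀ (z : ℂ) (a b : Fin 2), SmoothOn Ω (fun p => T z p a b)
  eq_x : ∀ (z : ℂ), ∀ p ∈ Ω,
    Matrix.of (fun a b => dx (fun p' => T z p' a b) p) + T z p * laxU q r z p
      = laxU q' r' z p * T z p
  eq_t : ∀ (z : ℂ), ∀ p ∈ Ω,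
    Matrix.of (fun a b => dt (fun p' => T z p' a b) p) + T z p * laxV q r z p
      = laxV q' r' z p * T z p

/-! ### The one-fold transformation and its iteration -/

/-- The values at a point of the one-fold Darboux matrix
`diag (√H, 1/√H) [[z/√h, -μ √h], [-μ/√h, z √h]]`,
where `s = √H` and `m = √h` are the chosen values of the square roots. -/
def oneFold (s m mu z : ℂ) : Matrix (Fin 2) (Fin 2) ℂ :=
  Matrix.diagonal ![s, 1 / s] * !![z / m, -mu * m; -mu / m, z * m]

/-- Potentials together with a sequence of eigenfunctions `(f j, g j)`. -/
structure Stage where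
  q : ℝ × ℝ → ℂ
  r : ℝ × ℝ → ℂ
  f : ℕ → ℝ × ℝ → ℂ
  g : ℕ → ℝ × ℝ → ℂ

/-- The ratio `h = f / g` for the eigenfunction with index `k`. -/
def Stage.h (S : Stage) (k : ℕ) (p : ℝ × ℝ) : ℂ := S.f k p / S.g k p

/-- One-fold transformation generated by the eigenfunction with index `k`, with chosen
square roots `s` of `H` and `m` of `h`. -/
def Stage.next (S : Stage) (lam : ℕ → ℂ) (k : ℕ) (s m : ℝ × ℝ → ℂ) : Stage where
  q := fun p => s p ^ 2 / S.h k p * (S.q p - 2 * I * lam k * S.h k p)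
  r := fun p => S.h k p / s p ^ 2 * (S.r p - 2 * I * (lam k / S.h k p))
  f := fun j p => (oneFold (s p) (m p) (lam k) (lam j) *ᵥ ![S.f j p, S.g j p]) 0
  g := fun j p => (oneFold (s p) (m p) (lam k) (lam j) *ᵥ ![S.f j p, S.g j p]) 1

/-- The stage `(q^{[k]}, r^{[k]}, Φ_j^{[k]})` reached after `k` one-fold transformations.
Eigenvalues and eigenfunctions are indexed from `0`; `sH k` and `sh k` are the chosen
square roots of `H^{[k]}` and of the ratio `f/g` generating step `k + 1`. -/
def stage (S : Stage) (lam : ℕ → ℂ) (sH sh : ℕ → ℝ × ℝ → ℂ) : ℕ → Stage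
  | 0 => S
  | k + 1 => (stage S lam sH sh k).next lam k (sH k) (sh k)

/-- The `n`-fold Darboux matrix `T_n = T_1^{[n-1]} ⋯ T_1^{[1]} T_1`. -/
def nFold (lam : ℕ → ℂ) (sH sh : ℕ → ℝ × ℝ → ℂ) :
    ℕ → ℂ → ℝ × ℝ → Matrix (Fin 2) (Fin 2) ℂ
  | 0, _, _ => 1
  | k + 1, z, p => oneFold (sH k p) (sh k p) (lam k) z * nFold lam sH sh k z p

/-- The first `n` steps of the iteration can be carried out on `Ω` with the smooth branches
`sH k` of `√H^{[k]}` and `sh k` of the square roots of the ratios `f/g`; the integration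
constants of `H^{[k]}`, `k ≥ 1`, are fixed by prescribing its value at the base point `p₀`. -/
structure IsIteration (Ω : Set (ℝ × ℝ)) (p₀ : ℝ × ℝ) (S : Stage) (lam : ℕ → ℂ)
    (sH sh : ℕ → ℝ × ℝ → ℂ) (n : ℕ) : Prop where
  f_ne_zero : ∀ k < n, ∀ p ∈ Ω, (stage S lam sH sh k).f k p ≠ 0
  g_ne_zero : ∀ k < n, ∀ p ∈ Ω, (stage S lam sH sh k).g k p ≠ 0
  smooth_sH : ∀ k < n, SmoothOn Ω (sH k)
  smooth_sh : ∀ k < n, SmoothOn Ω (sh k)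
  integral : ∀ k < n, IsIntegral Ω (stage S lam sH sh k).q (stage S lam sH sh k).r
    (fun p => sH k p ^ 2)
  sq_sh : ∀ k < n, ∀ p ∈ Ω, sh k p ^ 2 = (stage S lam sH sh k).h k p
  normalized : ∀ k, k + 1 < n → sH (k + 1) p₀ ^ 2 = (stage S lam sH sh k).h k p₀

/-! ### Vandermonde-type matrices and bordered determinants -/

/-- The matrix with rows `(λ_i^{n-1} a_i, λ_i^{n-2} b_i, λ_i^{n-3} a_i, λ_i^{n-4} b_i, …)`. -/
def vand (n : ℕ) (lam a b : ℕ → ℂ) : Matrix (Fin n) (Fin n) ℂ :=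
  Matrix.of fun i j => lam i ^ (n - 1 - (j : ℕ)) * (if Even (j : ℕ) then a i else b i)

/-- `W_n` at the point `p`. -/
def W (n : ℕ) (lam : ℕ → ℂ) (S : Stage) (p : ℝ × ℝ) : Matrix (Fin n) (Fin n) ℂ :=
  vand n lam (fun i => S.f i p) (fun i => S.g i p)

/-- `Ŵ_n` at the point `p`: the matrix `W_n` with the roles of `f` and `g` exchanged. -/
def What (n : ℕ) (lam : ℕ → ℂ) (S : Stage) (p : ℝ × ℝ) : Matrix (Fin n) (Fin n) ℂ :=
  vand n lam (fun i => S.g i p) (fun i => S.f i p)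

/-- The row `ξ_n = (z^{n-1}, 0, z^{n-3}, 0, …)`. -/
def xi (n : ℕ) (z : ℂ) : Fin n → ℂ :=
  fun j => if Even (j : ℕ) then z ^ (n - 1 - (j : ℕ)) else 0

/-- The row `ξ̂_n = (0, z^{n-2}, 0, z^{n-4}, …)`. -/
def xihat (n : ℕ) (z : ℂ) : Fin n → ℂ :=
  fun j => if Even (j : ℕ) then 0 else z ^ (n - 1 - (j : ℕ))

/-- The column `η_n = (λ_j^n g_j)`. -/
def eta (n : ℕ) (lam : ℕ → ℂ) (S : Stage) (p : ℝ × ℝ) : Fin n → ℂ :=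
  fun j => lam j ^ n * S.g j p

/-- The column `η̂_n = (λ_j^n f_j)`. -/
def etahat (n : ℕ) (lam : ℕ → ℂ) (S : Stage) (p : ℝ × ℝ) : Fin n → ℂ :=
  fun j => lam j ^ n * S.f j p

/-- The bordered determinant `| c  ξ ; η  M |`. -/
def bordered {n : ℕ} (c : ℂ) (row col : Fin n → ℂ) (M : Matrix (Fin n) (Fin n) ℂ) : ℂ :=
  (Matrix.fromBlocks (Matrix.of fun (_ _ : Unit) => c) (Matrix.replicateRow Unit row)
    (Matrix.replicateCol Unit col) M).det

/-- The `2 × 2` matrix of the bordered determinants `(T̂_n)_{ab}`. -/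
def That (n : ℕ) (lam : ℕ → ℂ) (S : Stage) (z : ℂ) (p : ℝ × ℝ) :
    Matrix (Fin 2) (Fin 2) ℂ :=
  !![bordered (z ^ n) (xihat n z) (etahat n lam S p) (What n lam S p),
     bordered 0 (xi n z) (etahat n lam S p) (What n lam S p);
     bordered 0 (xi n z) (eta n lam S p) (W n lam S p),
     bordered (z ^ n) (xihat n z) (eta n lam S p) (W n lam S p)]

/-- The determinant expression for `T_n`, where `D` is the value of `√(|W_n| |Ŵ_n|)` and `s`
the value of `√H`. -/
def detFormula (n : ℕ) (lam : ℕ → ℂ) (S : Stage) (s D z : ℂ) (p : ℝ × ℝ) :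
    Matrix (Fin 2) (Fin 2) ℂ :=
  if Even n then (1 / D) • That n lam S z p
  else (1 / D) • (Matrix.diagonal ![s, 1 / s] * That n lam S z p)

end CoupledDNLSII

end

noncomputable section

namespace CoupledDNLSII

open Complex Matrix
open scoped ContDiff

/-! The differential part concerns a single step. The ratio `h = f / g` satisfies Riccati equations,
so every derivative of the new potentials is a rational expression in `q`, `r`, their
`x`-derivatives, `h` and `H`. The new equations, the Darboux identities for the one-fold matrix and
the fact that `h` is an integral of the new potentials then become algebraic identities
(`IsSolution.next`, `isDarbouxMatrix_oneFold`, `IsRatio.isIntegral_next`). Darboux matrices compose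
and preserve eigenfunctions, so the step iterates. Two integrals of the same potentials that agree
at one point agree on the connected `Ω`, so the normalization at the base point forces each later
`H` to be the preceding ratio.

The determinant part is pointwise linear algebra. Each row of `T_n` has entries of complementary
parity in `z`, hence one coefficient vector per row besides a leading coefficient `a` or `1 / a`
(`exists_nFold_eq`). The kernel conditions `T_n(λ_j) Φ_j = 0` are linear equations for these
vectors, and Cramer's rule in bordered form gives `T̂_n = diag(|Ŵ_n| / a, |W_n| a) T_n` (`That_eq`).
Evaluating at the next eigenvalue yields a recursion for `|W_n|` and `|Ŵ_n|`, which proves that they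
do not vanish. The elimination of the later integrals makes `a` telescope, so `a² |W_n|` equals
`|Ŵ_n|`, times `H` for odd `n` (`leadCoeff_sq_mul_det`). This also exhibits the required square root
explicitly. -/

variable {Ω : Set (ℝ × ℝ)} {p : ℝ × ℝ} {u v : ℝ × ℝ → ℂ}

/-! ### Partial derivatives of smooth functions on an open set -/

lemma SmoothOn.differentiableAt (hΩ : IsOpen Ω) (hu : SmoothOn Ω u) (hp : p ∈ Ω) :
    DifferentiableAt ℝ u p :=
  (hu.contDiffAt (hΩ.mem_nhds hp)).differentiableAt (by simp)

lemma SmoothOn.hasDerivAt_fst (hΩ : IsOpen Ω) (hu : SmoothOn Ω u) (hp : p ∈ Ω) :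
    HasDerivAt (fun y : ℝ => u (y, p.2)) (fderiv ℝ u p (1, 0)) p.1 :=
  HasFDerivAt.comp_hasDerivAt (f := fun y : ℝ => (y, p.2)) p.1
    (hu.differentiableAt hΩ hp).hasFDerivAt
    ((hasDerivAt_id p.1).prodMk (hasDerivAt_const p.1 p.2))

lemma SmoothOn.hasDerivAt_snd (hΩ : IsOpen Ω) (hu : SmoothOn Ω u) (hp : p ∈ Ω) :
    HasDerivAt (fun y : ℝ => u (p.1, y)) (fderiv ℝ u p (0, 1)) p.2 :=
  HasFDerivAt.comp_hasDerivAt (f := fun y : ℝ => (p.1, y)) p.2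
    (hu.differentiableAt hΩ hp).hasFDerivAt
    ((hasDerivAt_const p.2 p.1).prodMk (hasDerivAt_id p.2))

lemma SmoothOn.dx_eq_fderiv (hΩ : IsOpen Ω) (hu : SmoothOn Ω u) (hp : p ∈ Ω) :
    dx u p = fderiv ℝ u p (1, 0) := (hu.hasDerivAt_fst hΩ hp).deriv

lemma SmoothOn.dt_eq_fderiv (hΩ : IsOpen Ω) (hu : SmoothOn Ω u) (hp : p ∈ Ω) :
    dt u p = fderiv ℝ u p (0, 1) := (hu.hasDerivAt_snd hΩ hp).deriv

lemma SmoothOn.hasDerivAt_dx (hΩ : IsOpen Ω) (hu : SmoothOn Ω u) (hp : p ∈ Ω) :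
    HasDerivAt (fun y : ℝ => u (y, p.2)) (dx u p) p.1 := by
  rw [hu.dx_eq_fderiv hΩ hp]; exact hu.hasDerivAt_fst hΩ hp

lemma SmoothOn.hasDerivAt_dt (hΩ : IsOpen Ω) (hu : SmoothOn Ω u) (hp : p ∈ Ω) :
    HasDerivAt (fun y : ℝ => u (p.1, y)) (dt u p) p.2 := by
  rw [hu.dt_eq_fderiv hΩ hp]; exact hu.hasDerivAt_snd hΩ hp

lemma SmoothOn.dx (hΩ : IsOpen Ω) (hu : SmoothOn Ω u) : SmoothOn Ω (dx u) := by
  have h : ContDiffOn ℝ ∞ (fderiv ℝ u) Ω := hu.fderiv_of_isOpen hΩ (by simp)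
  exact (h.clm_apply contDiffOn_const).congr fun p hp => hu.dx_eq_fderiv hΩ hp

lemma dx_congr (hΩ : IsOpen Ω) (h : Set.EqOn u v Ω) (hp : p ∈ Ω) : dx u p = dx v p := by
  refine Filter.EventuallyEq.deriv_eq ?_
  have hc : ContinuousAt (fun y : ℝ => (y, p.2)) p.1 := by fun_prop
  filter_upwards [hc.preimage_mem_nhds (hΩ.mem_nhds hp)] with y hy using h hy

lemma SmoothOn.dx_mul (hΩ : IsOpen Ω) (hu : SmoothOn Ω u) (hv : SmoothOn Ω v) (hp : p ∈ Ω) :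
    CoupledDNLSII.dx (fun p => u p * v p) p
      = CoupledDNLSII.dx u p * v p + u p * CoupledDNLSII.dx v p :=
  ((hu.hasDerivAt_dx hΩ hp).mul (hv.hasDerivAt_dx hΩ hp)).deriv

lemma SmoothOn.dt_mul (hΩ : IsOpen Ω) (hu : SmoothOn Ω u) (hv : SmoothOn Ω v) (hp : p ∈ Ω) :
    dt (fun p => u p * v p) p = dt u p * v p + u p * dt v p :=
  ((hu.hasDerivAt_dt hΩ hp).mul (hv.hasDerivAt_dt hΩ hp)).deriv

lemma SmoothOn.dx_add (hΩ : IsOpen Ω) (hu : SmoothOn Ω u) (hv : SmoothOn Ω v) (hp : p ∈ Ω) :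
    CoupledDNLSII.dx (fun p => u p + v p) p = CoupledDNLSII.dx u p + CoupledDNLSII.dx v p :=
  ((hu.hasDerivAt_dx hΩ hp).add (hv.hasDerivAt_dx hΩ hp)).deriv

lemma SmoothOn.dt_add (hΩ : IsOpen Ω) (hu : SmoothOn Ω u) (hv : SmoothOn Ω v) (hp : p ∈ Ω) :
    dt (fun p => u p + v p) p = dt u p + dt v p :=
  ((hu.hasDerivAt_dt hΩ hp).add (hv.hasDerivAt_dt hΩ hp)).deriv

lemma SmoothOn.dx_div (hΩ : IsOpen Ω) (hu : SmoothOn Ω u) (hv : SmoothOn Ω v) (hp : p ∈ Ω)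
    (h0 : v p ≠ 0) :
    CoupledDNLSII.dx (fun p => u p / v p) p
      = (CoupledDNLSII.dx u p * v p - u p * CoupledDNLSII.dx v p) / v p ^ 2 :=
  ((hu.hasDerivAt_dx hΩ hp).div (hv.hasDerivAt_dx hΩ hp) h0).deriv

lemma SmoothOn.dt_div (hΩ : IsOpen Ω) (hu : SmoothOn Ω u) (hv : SmoothOn Ω v) (hp : p ∈ Ω)
    (h0 : v p ≠ 0) :
    dt (fun p => u p / v p) p = (dt u p * v p - u p * dt v p) / v p ^ 2 :=
  ((hu.hasDerivAt_dt hΩ hp).div (hv.hasDerivAt_dt hΩ hp) h0).deriv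

lemma dx_const_mul (c : ℂ) : dx (fun p => c * u p) p = c * dx u p := by
  simp [dx]

lemma dt_const_mul (c : ℂ) : dt (fun p => c * u p) p = c * dt u p := by
  simp [dt]

lemma dx_const (c : ℂ) : dx (fun _ => c) p = 0 := by simp [dx]

lemma dt_const (c : ℂ) : dt (fun _ => c) p = 0 := by simp [dt]

lemma smoothOn_const (c : ℂ) : SmoothOn Ω fun _ => c := contDiffOn_const

lemma SmoothOn.mul (hu : SmoothOn Ω u) (hv : SmoothOn Ω v) : SmoothOn Ω fun p => u p * v p :=
  ContDiffOn.mul hu hv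

lemma SmoothOn.add (hu : SmoothOn Ω u) (hv : SmoothOn Ω v) : SmoothOn Ω fun p => u p + v p :=
  ContDiffOn.add hu hv

lemma SmoothOn.sub (hu : SmoothOn Ω u) (hv : SmoothOn Ω v) : SmoothOn Ω fun p => u p - v p :=
  ContDiffOn.sub hu hv

lemma SmoothOn.div (hu : SmoothOn Ω u) (hv : SmoothOn Ω v) (h0 : ∀ p ∈ Ω, v p ≠ 0) :
    SmoothOn Ω fun p => u p / v p :=
  (ContDiffOn.mul hu (ContDiffOn.inv hv h0)).congr fun p _ => div_eq_mul_inv (u p) (v p)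

/-- A smooth function with vanishing partial derivatives is constant on a connected open set. -/
lemma SmoothOn.eq_of_dx_eq_zero_of_dt_eq_zero (hΩ : IsOpen Ω) (hΩc : IsPreconnected Ω)
    (hu : SmoothOn Ω u) (hx : ∀ p ∈ Ω, CoupledDNLSII.dx u p = 0) (ht : ∀ p ∈ Ω, dt u p = 0)
    {p p' : ℝ × ℝ} (hp : p ∈ Ω) (hp' : p' ∈ Ω) : u p = u p' := by
  refine hΩ.is_const_of_fderiv_eq_zero hΩc
    (fun p hp => (hu.differentiableAt hΩ hp).differentiableWithinAt) (fun p hp => ?_) hp hp'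
  ext <;> simp [← hu.dx_eq_fderiv hΩ hp, ← hu.dt_eq_fderiv hΩ hp, hx p hp, ht p hp]

/-! ### The one-fold transformation of the potentials -/

/-- `h` is smooth, nowhere vanishing, and satisfies the Riccati equations of the ratio `f / g` of
the components of an eigenfunction with eigenvalue `μ`. -/
structure IsRatio (Ω : Set (ℝ × ℝ)) (q r : ℝ × ℝ → ℂ) (μ : ℂ) (h : ℝ × ℝ → ℂ) : Prop where
  smooth : SmoothOn Ω h
  ne_zero : ∀ p ∈ Ω, h p ≠ 0
  eq_x : ∀ p ∈ Ω, dx h p =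
    h p * (-2 * I * μ ^ 2 + I / 2 * q p * r p) + μ * q p + μ * r p * h p ^ 2
  eq_t : ∀ p ∈ Ω, dt h p =
    2 * h p * (-2 * I * μ ^ 4 + I * q p * r p * μ ^ 2 + 1 / 4 * (q p * dx r p - r p * dx q p)
      - I / 8 * q p ^ 2 * r p ^ 2)
    + (2 * μ ^ 3 * q p + μ * (I * dx q p - 1 / 2 * q p ^ 2 * r p))
    - (-2 * μ ^ 3 * r p + μ * (I * dx r p + 1 / 2 * r p ^ 2 * q p)) * h p ^ 2

variable {q r h H s m f g : ℝ × ℝ → ℂ} {μ : ℂ}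

lemma laxU_eq (q r : ℝ × ℝ → ℂ) (z : ℂ) (p : ℝ × ℝ) :
    laxU q r z p = !![-I * z ^ 2 + I / 4 * q p * r p, z * q p;
      -(z * r p), -(-I * z ^ 2 + I / 4 * q p * r p)] := by
  ext a b; fin_cases a <;> fin_cases b <;> simp [laxU, laxJ, laxQ]

lemma laxV_eq (q r : ℝ × ℝ → ℂ) (z : ℂ) (p : ℝ × ℝ) :
    laxV q r z p =
      !![-2 * I * z ^ 4 + I * q p * r p * z ^ 2 + 1 / 4 * (q p * dx r p - r p * dx q p)
          - I / 8 * q p ^ 2 * r p ^ 2,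
        2 * z ^ 3 * q p + z * (I * dx q p - 1 / 2 * q p ^ 2 * r p);
        -(2 * z ^ 3 * r p) + z * (I * dx r p + 1 / 2 * r p ^ 2 * q p),
        -(-2 * I * z ^ 4 + I * q p * r p * z ^ 2 + 1 / 4 * (q p * dx r p - r p * dx q p)
          - I / 8 * q p ^ 2 * r p ^ 2)] := by
  ext a b; fin_cases a <;> fin_cases b <;> simp [laxV, laxJ, laxQ, laxW]

/-- For a traceless system with matrix `A`, the quotient rule gives `h' = A₁₂ + 2 A₁₁ h - A₂₁ h²`;
both `U` and `V` are traceless. -/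
lemma IsEigenfunction.isRatio (hΩ : IsOpen Ω) (he : IsEigenfunction Ω q r μ f g)
    (hf : ∀ p ∈ Ω, f p ≠ 0) (hg : ∀ p ∈ Ω, g p ≠ 0) :
    IsRatio Ω q r μ fun p => f p / g p where
  smooth := he.smooth_f.div he.smooth_g hg
  ne_zero p hp := div_ne_zero (hf p hp) (hg p hp)
  eq_x p hp := by
    have h := he.eq_x p hp
    rw [laxU_eq] at h
    have h0 := congrFun h 0
    have h1 := congrFun h 1
    simp [mulVec, dotProduct, Fin.sum_univ_two] at h0 h1
    have := hg p hp
    rw [he.smooth_f.dx_div hΩ he.smooth_g hp this, h0, h1]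
    field_simp
    ring
  eq_t p hp := by
    have h := he.eq_t p hp
    rw [laxV_eq] at h
    have h0 := congrFun h 0
    have h1 := congrFun h 1
    simp [mulVec, dotProduct, Fin.sum_univ_two] at h0 h1
    have := hg p hp
    rw [he.smooth_f.dt_div hΩ he.smooth_g hp this, h0, h1]
    field_simp
    ring

/-- The first potential of the one-fold transform. -/
def nextQ (q h H : ℝ × ℝ → ℂ) (μ : ℂ) : ℝ × ℝ → ℂ :=
  fun p => H p / h p * (q p - 2 * I * μ * h p)

/-- The second potential of the one-fold transform. -/
def nextR (r h H : ℝ × ℝ → ℂ) (μ : ℂ) : ℝ × ℝ → ℂ :=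
  fun p => h p / H p * (r p - 2 * I * (μ / h p))

lemma smoothOn_nextQ (hq : SmoothOn Ω q) (hh : IsRatio Ω q r μ h) (hH : IsIntegral Ω q r H) :
    SmoothOn Ω (nextQ q h H μ) :=
  (hH.smooth.div hh.smooth hh.ne_zero).mul (hq.sub ((smoothOn_const _).mul hh.smooth))

lemma smoothOn_nextR (hr : SmoothOn Ω r) (hh : IsRatio Ω q r μ h) (hH : IsIntegral Ω q r H) :
    SmoothOn Ω (nextR r h H μ) :=
  (hh.smooth.div hH.smooth hH.ne_zero).mul
    (hr.sub ((smoothOn_const _).mul ((smoothOn_const _).div hh.smooth hh.ne_zero)))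

/-- The potential `r` drops out: the `qr` terms of `H_x / H` and `h_x / h` cancel, and `-2iμ H_x`
cancels the contribution of `μ r h²`. This keeps the second derivative short; `q` drops out of
`dx_nextR` in the same way. -/
lemma dx_nextQ (hΩ : IsOpen Ω) (hq : SmoothOn Ω q) (hh : IsRatio Ω q r μ h)
    (hH : IsIntegral Ω q r H) (hp : p ∈ Ω) :
    dx (nextQ q h H μ) p =
      H p * (dx q p / h p + 2 * I * μ ^ 2 * (q p / h p) - μ * (q p / h p) ^ 2) := by
  have h0 := hh.ne_zero p hp
  have key := (((hH.smooth.hasDerivAt_dx hΩ hp).div (hh.smooth.hasDerivAt_dx hΩ hp) h0).mul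
    ((hq.hasDerivAt_dx hΩ hp).sub ((hh.smooth.hasDerivAt_dx hΩ hp).const_mul (2 * I * μ)))).deriv
  refine key.trans ?_
  simp only [Pi.div_apply, Pi.sub_apply, hh.eq_x p hp, hH.eq_x p hp, Prod.mk.eta]
  field_simp
  ring_nf
  -- `ring` treats `I` as an atom, so `I² = -1` has to be supplied between the two normalizations.
  simp only [I_sq]
  ring

lemma dx_nextR (hΩ : IsOpen Ω) (hr : SmoothOn Ω r) (hh : IsRatio Ω q r μ h)
    (hH : IsIntegral Ω q r H) (hp : p ∈ Ω) :
    dx (nextR r h H μ) p =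
      (dx r p * h p - 2 * I * μ ^ 2 * (r p * h p) + μ * (r p * h p) ^ 2) / H p := by
  have h0 := hh.ne_zero p hp
  have H0 := hH.ne_zero p hp
  have key := (((hh.smooth.hasDerivAt_dx hΩ hp).div (hH.smooth.hasDerivAt_dx hΩ hp) H0).mul
    ((hr.hasDerivAt_dx hΩ hp).sub
      (((hasDerivAt_const p.1 μ).div (hh.smooth.hasDerivAt_dx hΩ hp) h0).const_mul
        (2 * I)))).deriv
  refine key.trans ?_
  simp only [Pi.div_apply, Pi.sub_apply, hh.eq_x p hp, hH.eq_x p hp, Prod.mk.eta]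
  field_simp
  ring_nf
  simp only [I_sq]
  ring

lemma dt_nextQ (hΩ : IsOpen Ω) (hq : SmoothOn Ω q) (hh : IsRatio Ω q r μ h)
    (hH : IsIntegral Ω q r H) (hp : p ∈ Ω) :
    dt (nextQ q h H μ) p =
      dt H p * (q p / h p - 2 * I * μ) + H p * (dt q p - q p / h p * dt h p) / h p := by
  have h0 := hh.ne_zero p hp
  have key := (((hH.smooth.hasDerivAt_dt hΩ hp).div (hh.smooth.hasDerivAt_dt hΩ hp) h0).mul
    ((hq.hasDerivAt_dt hΩ hp).sub ((hh.smooth.hasDerivAt_dt hΩ hp).const_mul (2 * I * μ)))).deriv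
  refine key.trans ?_
  simp only [Pi.div_apply, Pi.sub_apply, Prod.mk.eta]
  field_simp
  ring

lemma dt_nextR (hΩ : IsOpen Ω) (hr : SmoothOn Ω r) (hh : IsRatio Ω q r μ h)
    (hH : IsIntegral Ω q r H) (hp : p ∈ Ω) :
    dt (nextR r h H μ) p =
      (dt r p * h p + r p * dt h p - dt H p / H p * (r p * h p - 2 * I * μ)) / H p := by
  have h0 := hh.ne_zero p hp
  have H0 := hH.ne_zero p hp
  have key := (((hh.smooth.hasDerivAt_dt hΩ hp).div (hH.smooth.hasDerivAt_dt hΩ hp) H0).mul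
    ((hr.hasDerivAt_dt hΩ hp).sub
      (((hasDerivAt_const p.2 μ).div (hh.smooth.hasDerivAt_dt hΩ hp) h0).const_mul
        (2 * I)))).deriv
  refine key.trans ?_
  simp only [Pi.div_apply, Pi.sub_apply, Prod.mk.eta]
  field_simp
  ring

lemma dx_dx_nextQ (hΩ : IsOpen Ω) (hq : SmoothOn Ω q) (hh : IsRatio Ω q r μ h)
    (hH : IsIntegral Ω q r H) (hp : p ∈ Ω) :
    dx (dx (nextQ q h H μ)) p =
      dx H p * (dx q p / h p + 2 * I * μ ^ 2 * (q p / h p) - μ * (q p / h p) ^ 2)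
      + H p * ((dx (dx q) p - dx q p / h p * dx h p) / h p
        + (2 * I * μ ^ 2 - 2 * μ * (q p / h p)) * ((dx q p - q p / h p * dx h p) / h p)) := by
  have h0 := hh.ne_zero p hp
  -- The formula for the first derivative holds on the whole open set, so it may be differentiated
  -- again.
  rw [dx_congr hΩ (fun p hp => dx_nextQ hΩ hq hh hH hp) hp]
  have dq := (hq.hasDerivAt_dx hΩ hp).div (hh.smooth.hasDerivAt_dx hΩ hp) h0
  have key := ((hH.smooth.hasDerivAt_dx hΩ hp).mul
    (((((hq.dx hΩ).hasDerivAt_dx hΩ hp).div (hh.smooth.hasDerivAt_dx hΩ hp) h0).add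
      (dq.const_mul (2 * I * μ ^ 2))).sub ((dq.pow 2).const_mul μ))).deriv
  refine key.trans ?_
  simp only [Pi.div_apply, Pi.sub_apply, Pi.add_apply, Pi.pow_apply, Prod.mk.eta, Nat.reduceSub,
    pow_one, Nat.cast_ofNat]
  field_simp
  ring

lemma dx_dx_nextR (hΩ : IsOpen Ω) (hr : SmoothOn Ω r) (hh : IsRatio Ω q r μ h)
    (hH : IsIntegral Ω q r H) (hp : p ∈ Ω) :
    dx (dx (nextR r h H μ)) p =
      (dx (dx r) p * h p + dx r p * dx h p
        + (2 * μ * (r p * h p) - 2 * I * μ ^ 2) * (dx r p * h p + r p * dx h p)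
        - dx H p / H p *
          (dx r p * h p - 2 * I * μ ^ 2 * (r p * h p) + μ * (r p * h p) ^ 2)) / H p := by
  have H0 := hH.ne_zero p hp
  rw [dx_congr hΩ (fun p hp => dx_nextR hΩ hr hh hH hp) hp]
  have dr := (hr.hasDerivAt_dx hΩ hp).mul (hh.smooth.hasDerivAt_dx hΩ hp)
  have key := ((((((hr.dx hΩ).hasDerivAt_dx hΩ hp).mul (hh.smooth.hasDerivAt_dx hΩ hp)).sub
      (dr.const_mul (2 * I * μ ^ 2))).add ((dr.pow 2).const_mul μ)).div
        (hH.smooth.hasDerivAt_dx hΩ hp) H0).deriv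
  refine key.trans ?_
  simp only [Pi.mul_apply, Pi.sub_apply, Pi.add_apply, Pi.pow_apply, Prod.mk.eta, Nat.reduceSub,
    pow_one, Nat.cast_ofNat]
  field_simp
  ring

/-- Solving the equation for the time derivative lets the check of the new equations eliminate
`q_t`. -/
lemma IsSolution.dt_fst (hs : IsSolution Ω q r) (hp : p ∈ Ω) :
    dt q p = I * dx (dx q) p - q p * r p * dx q p := by
  linear_combination -I * hs.eq_q p hp + (dt q p + q p * r p * dx q p) * I_sq

lemma IsSolution.dt_snd (hs : IsSolution Ω q r) (hp : p ∈ Ω) :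
    dt r p = -I * dx (dx r) p - q p * r p * dx r p := by
  linear_combination -I * hs.eq_r p hp + (dt r p + q p * r p * dx r p) * I_sq

theorem IsSolution.next (hΩ : IsOpen Ω) (hs : IsSolution Ω q r) (hh : IsRatio Ω q r μ h)
    (hH : IsIntegral Ω q r H) : IsSolution Ω (nextQ q h H μ) (nextR r h H μ) where
  smooth_q := smoothOn_nextQ hs.smooth_q hh hH
  smooth_r := smoothOn_nextR hs.smooth_r hh hH
  eq_q p hp := by
    have h0 := hh.ne_zero p hp
    have H0 := hH.ne_zero p hp
    rw [dt_nextQ hΩ hs.smooth_q hh hH hp, dx_dx_nextQ hΩ hs.smooth_q hh hH hp,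
      dx_nextQ hΩ hs.smooth_q hh hH hp, hs.dt_fst hp, hh.eq_x p hp, hh.eq_t p hp, hH.eq_x p hp,
      hH.eq_t p hp, nextQ, nextR]
    field_simp
    ring_nf
    simp only [I_sq, I_pow_three, I_pow_four]
    ring
  eq_r p hp := by
    have h0 := hh.ne_zero p hp
    have H0 := hH.ne_zero p hp
    rw [dt_nextR hΩ hs.smooth_r hh hH hp, dx_dx_nextR hΩ hs.smooth_r hh hH hp,
      dx_nextR hΩ hs.smooth_r hh hH hp, hs.dt_snd hp, hh.eq_x p hp, hh.eq_t p hp, hH.eq_x p hp,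
      hH.eq_t p hp, nextQ, nextR]
    field_simp
    ring_nf
    simp only [I_sq, I_pow_three, I_pow_four]
    ring

/-- The ratio generating a one-fold transformation is an integral of the transformed potentials. -/
theorem IsRatio.isIntegral_next (hΩ : IsOpen Ω) (hq : SmoothOn Ω q) (hr : SmoothOn Ω r)
    (hh : IsRatio Ω q r μ h) (hH : IsIntegral Ω q r H) :
    IsIntegral Ω (nextQ q h H μ) (nextR r h H μ) h where
  smooth := hh.smooth
  ne_zero := hh.ne_zero
  eq_x p hp := by
    have h0 := hh.ne_zero p hp
    have H0 := hH.ne_zero p hp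
    -- `H` cancels in the product of the new potentials, and `(i/2) q' r'` is exactly the
    -- logarithmic derivative `h_x / h`.
    rw [hh.eq_x p hp, nextQ, nextR]
    field_simp
    ring_nf
    simp only [I_sq, I_pow_three]
    ring
  eq_t p hp := by
    have h0 := hh.ne_zero p hp
    have H0 := hH.ne_zero p hp
    have h5 : I ^ 5 = I := by rw [pow_succ, I_pow_four, one_mul]
    rw [hh.eq_t p hp, dx_nextQ hΩ hq hh hH hp, dx_nextR hΩ hr hh hH hp, nextQ, nextR]
    field_simp
    ring_nf
    simp only [I_sq, I_pow_three, I_pow_four, h5]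
    ring

/-- Two integrals of the same potentials which agree at one point agree everywhere. -/
theorem IsIntegral.eqOn (hΩ : IsOpen Ω) (hΩc : IsPreconnected Ω) {H₁ H₂ : ℝ × ℝ → ℂ}
    (h₁ : IsIntegral Ω q r H₁) (h₂ : IsIntegral Ω q r H₂) {p₀ : ℝ × ℝ} (hp₀ : p₀ ∈ Ω)
    (h0 : H₁ p₀ = H₂ p₀) : Set.EqOn H₁ H₂ Ω := by
  intro p hp
  -- The quotient of the two integrals has vanishing partial derivatives, since both have the same
  -- logarithmic derivatives.
  have key := (h₁.smooth.div h₂.smooth h₂.ne_zero).eq_of_dx_eq_zero_of_dt_eq_zero hΩ hΩc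
    (fun p hp => ?_) (fun p hp => ?_) hp hp₀
  · rw [h0, div_self (h₂.ne_zero p₀ hp₀), div_eq_one_iff_eq (h₂.ne_zero p hp)] at key
    exact key
  · rw [h₁.smooth.dx_div hΩ h₂.smooth hp (h₂.ne_zero p hp), h₁.eq_x p hp, h₂.eq_x p hp]
    ring
  · rw [h₁.smooth.dt_div hΩ h₂.smooth hp (h₂.ne_zero p hp), h₁.eq_t p hp, h₂.eq_t p hp]
    ring

/-! ### Darboux matrices -/

lemma oneFold_eq (s m μ z : ℂ) :
    oneFold s m μ z = !![z * (s / m), -μ * (s * m); -μ * (1 / (s * m)), z * (m / s)] := by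
  ext a b; fin_cases a <;> fin_cases b <;> simp [oneFold, diagonal_mul] <;> ring

lemma ne_zero_of_sq_eq {a b : ℂ} (h : a ^ 2 = b) (hb : b ≠ 0) : a ≠ 0 := by
  rintro rfl; simp at h; exact hb h.symm

lemma IsIntegral.dx_sqrt (hΩ : IsOpen Ω) (hH : IsIntegral Ω q r fun p => s p ^ 2)
    (hs : SmoothOn Ω s) (hp : p ∈ Ω) : dx s p = I / 4 * q p * r p * s p := by
  have h0 : s p ≠ 0 := ne_zero_of_sq_eq rfl (hH.ne_zero p hp)
  have h := hH.eq_x p hp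
  simp only [sq, hs.dx_mul hΩ hs hp] at h
  apply mul_left_cancel₀ h0
  linear_combination h / 2

lemma IsIntegral.dt_sqrt (hΩ : IsOpen Ω) (hH : IsIntegral Ω q r fun p => s p ^ 2)
    (hs : SmoothOn Ω s) (hp : p ∈ Ω) : dt s p =
      -(1 / 8) * s p * (I * q p ^ 2 * r p ^ 2 - 2 * q p * dx r p + 2 * r p * dx q p) := by
  have h0 : s p ≠ 0 := ne_zero_of_sq_eq rfl (hH.ne_zero p hp)
  have h := hH.eq_t p hp
  simp only [sq, hs.dt_mul hΩ hs hp] at h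
  apply mul_left_cancel₀ h0
  linear_combination h / 2

lemma dt_congr (hΩ : IsOpen Ω) (h : Set.EqOn u v Ω) (hp : p ∈ Ω) : dt u p = dt v p := by
  refine Filter.EventuallyEq.deriv_eq ?_
  have hc : ContinuousAt (fun y : ℝ => (p.1, y)) p.2 := by fun_prop
  filter_upwards [hc.preimage_mem_nhds (hΩ.mem_nhds hp)] with y hy using h hy

lemma dx_sqrt (hΩ : IsOpen Ω) (hm : SmoothOn Ω m) (hmh : ∀ p ∈ Ω, m p ^ 2 = h p) (hp : p ∈ Ω)
    (h0 : m p ≠ 0) : dx m p = dx h p / (2 * m p) := by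
  have : dx h p = dx m p * m p + m p * dx m p := by
    rw [← hm.dx_mul hΩ hm hp]
    exact dx_congr hΩ (fun p hp => by rw [← hmh p hp, sq]) hp
  rw [this]; field_simp; ring

lemma dt_sqrt (hΩ : IsOpen Ω) (hm : SmoothOn Ω m) (hmh : ∀ p ∈ Ω, m p ^ 2 = h p) (hp : p ∈ Ω)
    (h0 : m p ≠ 0) : dt m p = dt h p / (2 * m p) := by
  have : dt h p = dt m p * m p + m p * dt m p := by
    rw [← hm.dt_mul hΩ hm hp]
    exact dt_congr hΩ (fun p hp => by rw [← hmh p hp, sq]) hp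
  rw [this]; field_simp; ring

/-- The one-fold matrix is a Darboux matrix for the one-fold transform of the potentials. -/
theorem isDarbouxMatrix_oneFold (hΩ : IsOpen Ω) (hq : SmoothOn Ω q) (hr : SmoothOn Ω r)
    (hh : IsRatio Ω q r μ h) (hs : SmoothOn Ω s) (hm : SmoothOn Ω m)
    (hH : IsIntegral Ω q r fun p => s p ^ 2) (hmh : ∀ p ∈ Ω, m p ^ 2 = h p) :
    IsDarbouxMatrix Ω q r (nextQ q h (fun p => s p ^ 2) μ) (nextR r h (fun p => s p ^ 2) μ)
      fun z p => oneFold (s p) (m p) μ z := by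
  have s0 : ∀ p ∈ Ω, s p ≠ 0 := fun p hp => ne_zero_of_sq_eq rfl (hH.ne_zero p hp)
  have m0 : ∀ p ∈ Ω, m p ≠ 0 := fun p hp => ne_zero_of_sq_eq (hmh p hp) (hh.ne_zero p hp)
  have sm0 : ∀ p ∈ Ω, s p * m p ≠ 0 := fun p hp => mul_ne_zero (s0 p hp) (m0 p hp)
  have hsm := hs.mul hm
  refine ⟨fun z a b => ?_, fun z p hp => ?_, fun z p hp => ?_⟩
  · simp only [oneFold_eq]
    fin_cases a <;> fin_cases b
    · exact (smoothOn_const z).mul (hs.div hm m0)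
    · exact (smoothOn_const (-μ)).mul hsm
    · exact (smoothOn_const (-μ)).mul ((smoothOn_const 1).div hsm sm0)
    · exact (smoothOn_const z).mul (hm.div hs s0)
  · have s1 := s0 p hp
    have m1 := m0 p hp
    have e : Matrix.of (fun a b => dx (fun p' => oneFold (s p') (m p') μ z a b) p) =
        !![z * ((dx s p * m p - s p * dx m p) / m p ^ 2),
          -μ * (dx s p * m p + s p * dx m p);
          -μ * (-(dx s p * m p + s p * dx m p) / (s p * m p) ^ 2),
          z * ((dx m p * s p - m p * dx s p) / s p ^ 2)] := by
      simp only [oneFold_eq]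
      ext a b; fin_cases a <;> fin_cases b
      · simp [dx_const_mul, hs.dx_div hΩ hm hp m1]
      · simp [← neg_mul, dx_const_mul, hs.dx_mul hΩ hm hp]
      · have := (smoothOn_const (Ω := Ω) 1).dx_div hΩ hsm hp (sm0 p hp)
        rw [hs.dx_mul hΩ hm hp, dx_const] at this
        refine (dx_const_mul (u := fun p => 1 / (s p * m p)) (-μ)).trans ?_
        rw [this]
        simp
      · simp [dx_const_mul, hm.dx_div hΩ hs hp s1]
    rw [e, laxU_eq, laxU_eq, oneFold_eq, dx_sqrt hΩ hm hmh hp m1, hH.dx_sqrt hΩ hs hp,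
      hh.eq_x p hp]
    simp only [nextQ, nextR, ← hmh p hp]
    ext a b; fin_cases a <;> fin_cases b <;> simp [Matrix.mul_apply, Fin.sum_univ_two] <;>
      field_simp <;> ring_nf <;> simp only [I_sq, I_pow_three] <;> ring
  · have s1 := s0 p hp
    have m1 := m0 p hp
    have e : Matrix.of (fun a b => dt (fun p' => oneFold (s p') (m p') μ z a b) p) =
        !![z * ((dt s p * m p - s p * dt m p) / m p ^ 2),
          -μ * (dt s p * m p + s p * dt m p);
          -μ * (-(dt s p * m p + s p * dt m p) / (s p * m p) ^ 2),
          z * ((dt m p * s p - m p * dt s p) / s p ^ 2)] := by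
      simp only [oneFold_eq]
      ext a b; fin_cases a <;> fin_cases b
      · simp [dt_const_mul, hs.dt_div hΩ hm hp m1]
      · simp [← neg_mul, dt_const_mul, hs.dt_mul hΩ hm hp]
      · have := (smoothOn_const (Ω := Ω) 1).dt_div hΩ hsm hp (sm0 p hp)
        rw [hs.dt_mul hΩ hm hp, dt_const] at this
        refine (dt_const_mul (u := fun p => 1 / (s p * m p)) (-μ)).trans ?_
        rw [this]
        simp
      · simp [dt_const_mul, hm.dt_div hΩ hs hp s1]
    have h5 : I ^ 5 = I := by rw [pow_succ, I_pow_four, one_mul]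
    rw [e, laxV_eq, laxV_eq, oneFold_eq, dt_sqrt hΩ hm hmh hp m1, hH.dt_sqrt hΩ hs hp,
      hh.eq_t p hp, dx_nextQ hΩ hq hh hH hp, dx_nextR hΩ hr hh hH hp]
    simp only [nextQ, nextR, ← hmh p hp]
    ext a b; fin_cases a <;> fin_cases b <;> simp [Matrix.mul_apply, Fin.sum_univ_two] <;>
      field_simp <;> ring_nf <;> simp only [I_sq, I_pow_three, I_pow_four, h5] <;> ring

/-! ### Composition of Darboux matrices and their action on eigenfunctions. -/

variable {q' r' q'' r'' : ℝ × ℝ → ℂ} {T T' : ℂ → ℝ × ℝ → Matrix (Fin 2) (Fin 2) ℂ}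

lemma isDarbouxMatrix_one : IsDarbouxMatrix Ω q r q r fun _ _ => 1 where
  smooth _ _ _ := smoothOn_const _
  eq_x z p hp := by
    simp only [dx_const]
    ext a b; simp
  eq_t z p hp := by
    simp only [dt_const]
    ext a b; simp

lemma dx_matrix_mul (hΩ : IsOpen Ω) {A B : ℝ × ℝ → Matrix (Fin 2) (Fin 2) ℂ}
    (hA : ∀ a b, SmoothOn Ω fun p => A p a b) (hB : ∀ a b, SmoothOn Ω fun p => B p a b)
    (hp : p ∈ Ω) :
    Matrix.of (fun a b => dx (fun p' => (A p' * B p') a b) p) =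
      Matrix.of (fun a b => dx (fun p' => A p' a b) p) * B p
        + A p * Matrix.of (fun a b => dx (fun p' => B p' a b) p) := by
  ext a b
  simp only [Matrix.mul_apply, Fin.sum_univ_two, Matrix.of_apply, Matrix.add_apply]
  rw [((hA a 0).mul (hB 0 b)).dx_add hΩ ((hA a 1).mul (hB 1 b)) hp,
    (hA a 0).dx_mul hΩ (hB 0 b) hp, (hA a 1).dx_mul hΩ (hB 1 b) hp]
  ring

lemma dt_matrix_mul (hΩ : IsOpen Ω) {A B : ℝ × ℝ → Matrix (Fin 2) (Fin 2) ℂ}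
    (hA : ∀ a b, SmoothOn Ω fun p => A p a b) (hB : ∀ a b, SmoothOn Ω fun p => B p a b)
    (hp : p ∈ Ω) :
    Matrix.of (fun a b => dt (fun p' => (A p' * B p') a b) p) =
      Matrix.of (fun a b => dt (fun p' => A p' a b) p) * B p
        + A p * Matrix.of (fun a b => dt (fun p' => B p' a b) p) := by
  ext a b
  simp only [Matrix.mul_apply, Fin.sum_univ_two, Matrix.of_apply, Matrix.add_apply]
  rw [((hA a 0).mul (hB 0 b)).dt_add hΩ ((hA a 1).mul (hB 1 b)) hp,
    (hA a 0).dt_mul hΩ (hB 0 b) hp, (hA a 1).dt_mul hΩ (hB 1 b) hp]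
  ring

/-- Darboux matrices compose. -/
theorem IsDarbouxMatrix.mul (hΩ : IsOpen Ω) (hT' : IsDarbouxMatrix Ω q' r' q'' r'' T')
    (hT : IsDarbouxMatrix Ω q r q' r' T) :
    IsDarbouxMatrix Ω q r q'' r'' fun z p => T' z p * T z p where
  smooth z a b := by
    simp only [Matrix.mul_apply, Fin.sum_univ_two]
    exact ((hT'.smooth z a 0).mul (hT.smooth z 0 b)).add
      ((hT'.smooth z a 1).mul (hT.smooth z 1 b))
  eq_x z p hp := by
    rw [dx_matrix_mul hΩ (hT'.smooth z) (hT.smooth z) hp, add_assoc, mul_assoc, ← mul_add,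
      hT.eq_x z p hp, ← mul_assoc, ← mul_assoc, ← add_mul, hT'.eq_x z p hp]
  eq_t z p hp := by
    rw [dt_matrix_mul hΩ (hT'.smooth z) (hT.smooth z) hp, add_assoc, mul_assoc, ← mul_add,
      hT.eq_t z p hp, ← mul_assoc, ← mul_assoc, ← add_mul, hT'.eq_t z p hp]

/-- A Darboux matrix maps eigenfunctions to eigenfunctions. -/
theorem IsDarbouxMatrix.isEigenfunction (hΩ : IsOpen Ω) (hT : IsDarbouxMatrix Ω q r q' r' T)
    {z : ℂ} (he : IsEigenfunction Ω q r z f g) :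
    IsEigenfunction Ω q' r' z (fun p => (T z p *ᵥ ![f p, g p]) 0)
      (fun p => (T z p *ᵥ ![f p, g p]) 1) := by
  have hT0 := hT.smooth z
  have sm : ∀ a, SmoothOn Ω fun p => (T z p *ᵥ ![f p, g p]) a := fun a => by
    simp only [mulVec, dotProduct, Fin.sum_univ_two, Matrix.cons_val_zero, Matrix.cons_val_one]
    exact ((hT0 a 0).mul he.smooth_f).add ((hT0 a 1).mul he.smooth_g)
  have eta : ∀ w : Fin 2 → ℂ, ![w 0, w 1] = w := fun w => by
    ext a; fin_cases a <;> rfl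
  refine ⟨sm 0, sm 1, fun p hp => ?_, fun p hp => ?_⟩
  · have key : ∀ a, dx (fun p => (T z p *ᵥ ![f p, g p]) a) p =
        (Matrix.of (fun a b => dx (fun p' => T z p' a b) p) *ᵥ ![f p, g p]
          + T z p *ᵥ ![dx f p, dx g p]) a := fun a => by
      simp only [mulVec, dotProduct, Fin.sum_univ_two, Matrix.cons_val_zero, Matrix.cons_val_one,
        Matrix.of_apply, Pi.add_apply]
      rw [((hT0 a 0).mul he.smooth_f).dx_add hΩ ((hT0 a 1).mul he.smooth_g) hp,
        (hT0 a 0).dx_mul hΩ he.smooth_f hp, (hT0 a 1).dx_mul hΩ he.smooth_g hp]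
      ring
    rw [key 0, key 1, eta, eta, he.eq_x p hp, mulVec_mulVec, mulVec_mulVec, ← add_mulVec,
      hT.eq_x z p hp]
  · have key : ∀ a, dt (fun p => (T z p *ᵥ ![f p, g p]) a) p =
        (Matrix.of (fun a b => dt (fun p' => T z p' a b) p) *ᵥ ![f p, g p]
          + T z p *ᵥ ![dt f p, dt g p]) a := fun a => by
      simp only [mulVec, dotProduct, Fin.sum_univ_two, Matrix.cons_val_zero, Matrix.cons_val_one,
        Matrix.of_apply, Pi.add_apply]
      rw [((hT0 a 0).mul he.smooth_f).dt_add hΩ ((hT0 a 1).mul he.smooth_g) hp,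
        (hT0 a 0).dt_mul hΩ he.smooth_f hp, (hT0 a 1).dt_mul hΩ he.smooth_g hp]
      ring
    rw [key 0, key 1, eta, eta, he.eq_t p hp, mulVec_mulVec, mulVec_mulVec, ← add_mulVec,
      hT.eq_t z p hp]

/-! ### Bordered determinants -/

/-- Cramer's rule without an invertibility assumption: subtracting from the first column the
combination `v` of the others clears it below the corner. -/
lemma bordered_mulVec {n : ℕ} (c : ℂ) (row v : Fin n → ℂ) (M : Matrix (Fin n) (Fin n) ℂ) :
    bordered c row (M *ᵥ v) M = (c - row ⬝ᵥ v) * M.det := by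
  have : Matrix.fromBlocks (Matrix.of fun (_ _ : Unit) => c) (Matrix.replicateRow Unit row)
      (Matrix.replicateCol Unit (M *ᵥ v)) M =
      Matrix.fromBlocks (Matrix.of fun (_ _ : Unit) => c - row ⬝ᵥ v)
        (Matrix.replicateRow Unit row) 0 M *
      Matrix.fromBlocks 1 0 (Matrix.replicateCol Unit v) 1 := by
    rw [Matrix.fromBlocks_multiply]
    congr 1
    · ext; simp [Matrix.mul_apply, dotProduct]
    · simp
    · ext; simp [Matrix.mul_apply, mulVec, dotProduct]
    · simp
  rw [bordered, this, det_mul, det_fromBlocks_zero₂₁, det_fromBlocks_zero₁₂]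
  simp

/-- The bijection sending the distinguished index to the first place. -/
def firstEquiv (n : ℕ) : Unit ⊕ Fin n ≃ Fin (n + 1) :=
  (((finSuccEquiv n).trans (Equiv.optionEquivSumPUnit _)).trans (Equiv.sumComm _ _)).symm

/-- The bijection sending the distinguished index to the last place. -/
def lastEquiv (n : ℕ) : Unit ⊕ Fin n ≃ Fin (n + 1) :=
  (((finSuccEquivLast (n := n)).trans (Equiv.optionEquivSumPUnit _)).trans
    (Equiv.sumComm _ _)).symm

/-- The sign of the cyclic permutation which moves the last row to the top. -/
def cycleSign (n : ℕ) : ℂ :=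
  ((Equiv.Perm.sign ((firstEquiv n).symm.trans (lastEquiv n)) : ℤ) : ℂ)

lemma cycleSign_ne_zero (n : ℕ) : cycleSign n ≠ 0 := by
  simp [cycleSign]

lemma det_submatrix_lastEquiv {n : ℕ} (M : Matrix (Fin (n + 1)) (Fin (n + 1)) ℂ) :
    (M.submatrix (lastEquiv n) (firstEquiv n)).det = cycleSign n * M.det := by
  -- Only rows are permuted here; reindexing rows and columns together by `firstEquiv` then turns
  -- the row map into `lastEquiv` and leaves the determinant unchanged.
  have := det_permute ((firstEquiv n).symm.trans (lastEquiv n)) M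
  rw [← det_submatrix_equiv_self (firstEquiv n)] at this
  simpa [Function.comp_def, cycleSign] using this

lemma vand_apply (n : ℕ) (lam a b : ℕ → ℂ) (i j : Fin n) :
    vand n lam a b i j = xi n (lam i) j * a i + xihat n (lam i) j * b i := by
  by_cases h : Even (j : ℕ) <;> simp [vand, xi, xihat, h]

lemma vand_mulVec (n : ℕ) (lam a b : ℕ → ℂ) (v : Fin n → ℂ) (i : Fin n) :
    (vand n lam a b *ᵥ v) i =
      (xi n (lam i) ⬝ᵥ v) * a i + (xihat n (lam i) ⬝ᵥ v) * b i := by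
  simp only [mulVec, dotProduct, vand_apply, Finset.sum_mul, ← Finset.sum_add_distrib]
  exact Finset.sum_congr rfl fun _ _ => by ring

/-- Deleting the first column of the matrix of size `n + 1` shifts the alternation by one, so the
first `n` rows leave the matrix of size `n` with `a` and `b` exchanged. The last row, moved to the
top, is the border. -/
lemma bordered_vand (n : ℕ) (lam a b : ℕ → ℂ) :
    bordered (lam n ^ n * a n) (a n • xihat n (lam n) + b n • xi n (lam n))
      (fun j => lam j ^ n * a j) (vand n lam b a) = cycleSign n * (vand (n + 1) lam a b).det := by
  rw [← det_submatrix_lastEquiv, bordered]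
  congr 1
  ext i j
  rcases i with i | i <;> rcases j with j | j
  · simp [firstEquiv, lastEquiv, vand]
  · by_cases h : Even (j : ℕ) <;>
      simp [firstEquiv, lastEquiv, vand, xi, xihat, h, Nat.even_add_one, Nat.sub_sub, add_comm,
        mul_comm]
  · simp [firstEquiv, lastEquiv, vand]
  · by_cases h : Even (j : ℕ) <;>
      simp [firstEquiv, lastEquiv, vand, h, Nat.even_add_one, Nat.sub_sub, add_comm]

/-- Coefficient bookkeeping for `exists_nFold_eq`: appending a zero multiplies the polynomial by
`z`, whereas prepending an entry (`xi_cons`, `xihat_cons`) exchanges the two parities. -/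
lemma xi_snoc (n : ℕ) (z : ℂ) (v : Fin n → ℂ) :
    xi (n + 1) z ⬝ᵥ (Fin.snoc v 0 : Fin (n + 1) → ℂ) = z * (xi n z ⬝ᵥ v) := by
  simp only [dotProduct, Fin.sum_univ_castSucc, Fin.snoc_castSucc, Fin.snoc_last, mul_zero,
    add_zero, Finset.mul_sum, xi, Fin.val_castSucc]
  refine Finset.sum_congr rfl fun j _ => ?_
  have : n + 1 - 1 - (j : ℕ) = n - 1 - j + 1 := by omega
  split_ifs
  · rw [this]; ring
  · simp

lemma xihat_snoc (n : ℕ) (z : ℂ) (v : Fin n → ℂ) :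
    xihat (n + 1) z ⬝ᵥ (Fin.snoc v 0 : Fin (n + 1) → ℂ) = z * (xihat n z ⬝ᵥ v) := by
  simp only [dotProduct, Fin.sum_univ_castSucc, Fin.snoc_castSucc, Fin.snoc_last, mul_zero,
    add_zero, Finset.mul_sum, xihat, Fin.val_castSucc]
  refine Finset.sum_congr rfl fun j _ => ?_
  have : n + 1 - 1 - (j : ℕ) = n - 1 - j + 1 := by omega
  split_ifs
  · simp
  · rw [this]; ring

lemma xi_cons (n : ℕ) (z c : ℂ) (v : Fin n → ℂ) :
    xi (n + 1) z ⬝ᵥ (Fin.cons c v : Fin (n + 1) → ℂ) = c * z ^ n + xihat n z ⬝ᵥ v := by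
  simp only [dotProduct, Fin.sum_univ_succ, Fin.cons_zero, Fin.cons_succ]
  congr 1
  · simp [xi, mul_comm]
  · refine Finset.sum_congr rfl fun j _ => ?_
    by_cases h : Even (j : ℕ) <;> simp [xi, xihat, h, Nat.even_add_one, Nat.sub_sub, add_comm]

lemma xihat_cons (n : ℕ) (z c : ℂ) (v : Fin n → ℂ) :
    xihat (n + 1) z ⬝ᵥ (Fin.cons c v : Fin (n + 1) → ℂ) = xi n z ⬝ᵥ v := by
  simp only [dotProduct, Fin.sum_univ_succ, Fin.cons_zero, Fin.cons_succ]
  have : xihat (n + 1) z 0 = 0 := by simp [xihat]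
  rw [this, zero_mul, zero_add]
  refine Finset.sum_congr rfl fun j _ => ?_
  by_cases h : Even (j : ℕ) <;> simp [xi, xihat, h, Nat.even_add_one, Nat.sub_sub, add_comm]

/-! ### The determinant formula -/

/-- The coefficient of `z ^ n` in the upper left entry of the `n`-fold matrix. -/
def leadCoeff (sH sh : ℕ → ℝ × ℝ → ℂ) (n : ℕ) (p : ℝ × ℝ) : ℂ :=
  ∏ k ∈ Finset.range n, sH k p / sh k p

variable {lam : ℕ → ℂ} {sH sh : ℕ → ℝ × ℝ → ℂ} {S : Stage}

lemma leadCoeff_succ (n : ℕ) (p : ℝ × ℝ) :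
    leadCoeff sH sh (n + 1) p = leadCoeff sH sh n p * (sH n p / sh n p) :=
  Finset.prod_range_succ _ _

lemma leadCoeff_ne_zero {n : ℕ} (hs : ∀ k < n, sH k p ≠ 0) (hm : ∀ k < n, sh k p ≠ 0) :
    leadCoeff sH sh n p ≠ 0 :=
  Finset.prod_ne_zero_iff.2 fun k hk =>
    div_ne_zero (hs k (Finset.mem_range.1 hk)) (hm k (Finset.mem_range.1 hk))

/-- The entries of the `n`-fold matrix are polynomials in `z` of alternating parity. -/
lemma exists_nFold_eq (n : ℕ) (hs : ∀ k < n, sH k p ≠ 0) (hm : ∀ k < n, sh k p ≠ 0) :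
    ∃ v w : Fin n → ℂ, ∀ z, nFold lam sH sh n z p =
      !![leadCoeff sH sh n p * z ^ n + xihat n z ⬝ᵥ v, xi n z ⬝ᵥ v;
        xi n z ⬝ᵥ w, (leadCoeff sH sh n p)⁻¹ * z ^ n + xihat n z ⬝ᵥ w] := by
  induction n with
  | zero =>
    refine ⟨0, 0, fun z => ?_⟩
    simp [nFold, leadCoeff, Matrix.one_fin_two]
  | succ n ih =>
    obtain ⟨v, w, h⟩ := ih (fun k hk => hs k (by omega)) (fun k hk => hm k (by omega))
    have s0 := hs n (by omega)
    have m0 := hm n (by omega)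
    set a := leadCoeff sH sh n p with ha
    -- Left multiplication by the one-fold matrix combines `z` times a row with a multiple of the
    -- other row. The prepended entry carries the leading coefficient of that other row.
    refine ⟨(sH n p / sh n p) • Fin.snoc v 0 - (lam n * (sH n p * sh n p)) • Fin.cons a⁻¹ w,
      (sh n p / sH n p) • Fin.snoc w 0 - (lam n * (1 / (sH n p * sh n p))) • Fin.cons a v,
      fun z => ?_⟩
    rw [nFold, h z, oneFold_eq]
    simp only [dotProduct_sub, dotProduct_smul, xi_snoc, xihat_snoc, xi_cons, xihat_cons,
      smul_eq_mul, leadCoeff_succ, ← ha, Matrix.mul_fin_two]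
    congr 2 <;> [skip; congr 1] <;> ext i <;> fin_cases i <;> simp <;> ring

lemma stage_eq_nFold_mulVec (n j : ℕ) (p : ℝ × ℝ) :
    ![(stage S lam sH sh n).f j p, (stage S lam sH sh n).g j p] =
      nFold lam sH sh n (lam j) p *ᵥ ![S.f j p, S.g j p] := by
  induction n with
  | zero => simp [stage, nFold]
  | succ n ih =>
    rw [nFold, ← mulVec_mulVec, ← ih]
    ext i; fin_cases i <;> rfl

/-- At `z = λ_j` the one-fold matrix of the step generated by index `j` annihilates the current
eigenfunction, because `m² g = f`; later steps keep it zero. -/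
lemma nFold_mulVec_eq_zero {N : ℕ} (hm : ∀ k < N, sh k p ≠ 0)
    (hg : ∀ k < N, (stage S lam sH sh k).g k p ≠ 0)
    (hsq : ∀ k < N, sh k p ^ 2 = (stage S lam sH sh k).h k p) {j : ℕ} (hj : j < N) :
    nFold lam sH sh N (lam j) p *ᵥ ![S.f j p, S.g j p] = 0 := by
  induction N with
  | zero => omega
  | succ N ih =>
    rw [nFold, ← mulVec_mulVec]
    rcases Nat.lt_succ_iff_lt_or_eq.1 hj with hj' | rfl
    · rw [ih (fun k hk => hm k (by omega)) (fun k hk => hg k (by omega))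
        (fun k hk => hsq k (by omega)) hj', mulVec_zero]
    · rw [← stage_eq_nFold_mulVec, oneFold_eq]
      have h := hsq j hj
      rw [Stage.h, eq_div_iff (hg j hj)] at h
      have m0 := hm j hj
      ext i; fin_cases i <;> simp [← h] <;> field_simp <;> ring

/-- The bordered determinants are proportional to the rows of the `n`-fold matrix. -/
lemma That_eq {n : ℕ} (hs : ∀ k < n, sH k p ≠ 0) (hm : ∀ k < n, sh k p ≠ 0)
    (hker : ∀ j < n, nFold lam sH sh n (lam j) p *ᵥ ![S.f j p, S.g j p] = 0) (z : ℂ) :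
    That n lam S z p = Matrix.diagonal ![(What n lam S p).det / leadCoeff sH sh n p,
      (W n lam S p).det * leadCoeff sH sh n p] * nFold lam sH sh n z p := by
  obtain ⟨v, w, h⟩ := exists_nFold_eq (lam := lam) n hs hm
  have a0 := leadCoeff_ne_zero hs hm
  set a := leadCoeff sH sh n p with ha
  -- The first component of `T_n(λ_j) Φ_j = 0` reads `Ŵ_n v = -a η̂_n`; the second component gives
  -- the analogous relation for `w`. Neither determinant is assumed nonzero, which allows this lemma
  -- to be used in proving that they are.
  have hcol₁ : etahat n lam S p = What n lam S p *ᵥ (-a⁻¹ • v) := by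
    ext j
    have := congrFun (hker j j.2) 0
    simp [h, mulVec, dotProduct] at this
    rw [What, vand_mulVec]
    simp only [dotProduct_smul, smul_eq_mul, etahat]
    field_simp
    simp only [dotProduct]
    linear_combination this
  have hcol₂ : eta n lam S p = W n lam S p *ᵥ (-a • w) := by
    ext j
    have := congrFun (hker j j.2) 1
    simp [h, mulVec, dotProduct] at this
    rw [W, vand_mulVec]
    simp only [dotProduct_smul, smul_eq_mul, eta]
    field_simp at this
    simp only [dotProduct]
    linear_combination this
  rw [That, hcol₁, hcol₂]
  simp only [bordered_mulVec, h, dotProduct_smul, smul_eq_mul]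
  ext i j; fin_cases i <;> fin_cases j <;> simp [diagonal_mul] <;> field_simp

/-- Linearity in the first row. Invertibility of `M` serves only to write the column as `M *ᵥ v`, so
that `bordered_mulVec` applies. -/
lemma bordered_linear {n : ℕ} (c₁ c₂ a b : ℂ) (row₁ row₂ col : Fin n → ℂ)
    (M : Matrix (Fin n) (Fin n) ℂ) (hM : M.det ≠ 0) :
    bordered c₁ row₁ col M * a + bordered c₂ row₂ col M * b =
      bordered (c₁ * a + c₂ * b) (a • row₁ + b • row₂) col M := by
  have : col = M *ᵥ (M⁻¹ *ᵥ col) := by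
    rw [mulVec_mulVec, Matrix.mul_nonsing_inv _ hM.isUnit, one_mulVec]
  rw [this]
  simp only [bordered_mulVec, add_dotProduct, smul_dotProduct, smul_eq_mul]
  ring

/-- The bordered determinants map the next eigenfunction to the next pair of determinants. -/
lemma That_mulVec {n : ℕ} (hW : (W n lam S p).det ≠ 0) (hW' : (What n lam S p).det ≠ 0) :
    That n lam S (lam n) p *ᵥ ![S.f n p, S.g n p] =
      cycleSign n • ![(W (n + 1) lam S p).det, (What (n + 1) lam S p).det] := by
  have h₁ : _ = cycleSign n * (W (n + 1) lam S p).det :=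
    bordered_vand n lam (fun i => S.f i p) (fun i => S.g i p)
  have h₂ : _ = cycleSign n * (What (n + 1) lam S p).det :=
    bordered_vand n lam (fun i => S.g i p) (fun i => S.f i p)
  have e₁ := bordered_linear (lam n ^ n) 0 (S.f n p) (S.g n p) (xihat n (lam n)) (xi n (lam n))
    (etahat n lam S p) (What n lam S p) hW'
  have e₂ := bordered_linear 0 (lam n ^ n) (S.f n p) (S.g n p) (xi n (lam n)) (xihat n (lam n))
    (eta n lam S p) (W n lam S p) hW
  rw [zero_mul, add_zero] at e₁
  rw [zero_mul, zero_add, add_comm (_ • _)] at e₂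
  ext i; fin_cases i
  · simpa [That, mulVec, dotProduct] using e₁.trans h₁
  · simpa [That, mulVec, dotProduct] using e₂.trans h₂

/-- The determinants do not vanish, and their quotient is the square of the leading coefficient,
up to the factor `H` for an odd number of steps. -/
lemma leadCoeff_sq_mul_det {N : ℕ} (hs : ∀ k < N, sH k p ≠ 0) (hm : ∀ k < N, sh k p ≠ 0)
    (hf : ∀ k < N, (stage S lam sH sh k).f k p ≠ 0)
    (hg : ∀ k < N, (stage S lam sH sh k).g k p ≠ 0)
    (hsq : ∀ k < N, sh k p ^ 2 = (stage S lam sH sh k).h k p)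
    (hint : ∀ k, k + 1 < N → sH (k + 1) p ^ 2 = sh k p ^ 2) {n : ℕ} (hn : n ≤ N) :
    (W n lam S p).det ≠ 0 ∧ (What n lam S p).det ≠ 0 ∧
      leadCoeff sH sh n p ^ 2 * (W n lam S p).det =
        (What n lam S p).det * if Even n then 1 else sH 0 p ^ 2 := by
  induction n with
  | zero => simp [leadCoeff]
  | succ n ih =>
    obtain ⟨hW, hW', hρ⟩ := ih (by omega)
    have hs' : ∀ k < n, sH k p ≠ 0 := fun k hk => hs k (by omega)
    have hm' : ∀ k < n, sh k p ≠ 0 := fun k hk => hm k (by omega)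
    have a0 := leadCoeff_ne_zero hs' hm'
    -- Computing `T̂_n(λ_n) Φ_n` in two ways gives, with a common sign `ε`, `|Ŵ_n| F / a = ε
    -- |W_{n+1}|` and `|W_n| a G = ε |Ŵ_{n+1}|`, where `(F, G)` is the eigenfunction at stage `n`.
    have hT := That_mulVec hW hW'
    rw [That_eq hs' hm' (fun j hj => nFold_mulVec_eq_zero hm' (fun k hk => hg k (by omega))
      (fun k hk => hsq k (by omega)) hj), ← mulVec_mulVec, ← stage_eq_nFold_mulVec] at hT
    have hT₁ := congrFun hT 0
    have hT₂ := congrFun hT 1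
    simp at hT₁ hT₂
    have F0 := hf n (by omega)
    have G0 := hg n (by omega)
    have s0 := hs n (by omega)
    have m0 := hm n (by omega)
    have h0 := hs 0 (by omega)
    have hmn := hsq n (by omega)
    rw [Stage.h, eq_div_iff G0] at hmn
    -- Since `sH (k + 1)² = sh k²`, the squared product defining `leadCoeff` telescopes.
    have hH : sH n p ^ 2 * leadCoeff sH sh n p ^ 2 = sH 0 p ^ 2 := by
      rcases n with _ | n
      · simp [leadCoeff]
      · have m1 := hm n (by omega)
        clear ih hρ hT hT₁ hT₂ hW hW' a0 F0 G0 hmn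
        suffices ∀ k, k + 1 < N → sH (k + 1) p ^ 2 * leadCoeff sH sh (k + 1) p ^ 2
            = sH 0 p ^ 2 from this n (by omega)
        intro k hk
        induction k with
        | zero =>
          have := hm 0 (by omega)
          rw [hint 0 hk]
          simp [leadCoeff]
          field_simp
        | succ k ih =>
          have := hm (k + 1) (by omega)
          rw [hint (k + 1) hk, leadCoeff_succ, ← ih (by omega)]
          field_simp
    have hε := cycleSign_ne_zero n
    have hW₁ : (W (n + 1) lam S p).det ≠ 0 := by
      rintro h
      rw [h, mul_zero] at hT₁
      exact mul_ne_zero (div_ne_zero hW' a0) F0 hT₁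
    have hW₂ : (What (n + 1) lam S p).det ≠ 0 := by
      rintro h
      rw [h, mul_zero] at hT₂
      exact mul_ne_zero (mul_ne_zero hW a0) G0 hT₂
    refine ⟨hW₁, hW₂, ?_⟩
    set a := leadCoeff sH sh n p
    set F := (stage S lam sH sh n).f n p
    set G := (stage S lam sH sh n).g n p
    -- The quotient of the two recursions, with `F = m² G`; the sign cancels, so its value never
    -- matters.
    have hquot : (What (n + 1) lam S p).det * (What n lam S p).det * sh n p ^ 2 =
        (W n lam S p).det * a ^ 2 * (W (n + 1) lam S p).det := by
      apply mul_left_cancel₀ hε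
      field_simp at hT₁
      linear_combination (W n lam S p).det * a * hT₁ - (What n lam S p).det * sh n p ^ 2 * hT₂
        + (W n lam S p).det * a * (What n lam S p).det * hmn
    -- The factor `H` alternates: the telescoped identity contributes one `H` at each step, which
    -- cancels the one already present when `n` is odd.
    have hstep : sH n p ^ 2 * (What n lam S p).det =
        (W n lam S p).det * if Even (n + 1) then 1 else sH 0 p ^ 2 := by
      by_cases hev : Even n
      · simp only [hev, Nat.even_add_one, not_true, if_true, if_false] at hρ ⊢
        linear_combination (W n lam S p).det * hH - sH n p ^ 2 * hρ
      · simp only [hev, Nat.even_add_one, not_false_iff, if_true, if_false] at hρ ⊢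
        apply mul_right_cancel₀ (pow_ne_zero 2 h0)
        linear_combination (W n lam S p).det * hH - sH n p ^ 2 * hρ
    rw [leadCoeff_succ]
    field_simp
    apply mul_left_cancel₀ hW
    linear_combination (What (n + 1) lam S p).det * sh n p ^ 2 * hstep - sH n p ^ 2 * hquot

/-! ### The iteration on `Ω`: stages, elimination of integrals, smoothness. -/

variable {p₀ : ℝ × ℝ} {n : ℕ}

/-- The inductive description of the stages of the iteration. -/
lemma IsIteration.stage_spec (hΩ : IsOpen Ω) (hseed : IsSolution Ω S.q S.r)
    (heig : ∀ j < n, IsEigenfunction Ω S.q S.r (lam j) (S.f j) (S.g j))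
    (hiter : IsIteration Ω p₀ S lam sH sh n) {k : ℕ} (hk : k ≤ n) :
    IsSolution Ω (stage S lam sH sh k).q (stage S lam sH sh k).r ∧
    IsDarbouxMatrix Ω S.q S.r (stage S lam sH sh k).q (stage S lam sH sh k).r
      (nFold lam sH sh k) ∧
    (∀ j < n, IsEigenfunction Ω (stage S lam sH sh k).q (stage S lam sH sh k).r (lam j)
      ((stage S lam sH sh k).f j) ((stage S lam sH sh k).g j)) := by
  induction k with
  | zero => exact ⟨hseed, isDarbouxMatrix_one, heig⟩
  | succ k ih =>
    obtain ⟨hsol, hdar, hef⟩ := ih (by omega)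
    have hh := (hef k (by omega)).isRatio hΩ (hiter.f_ne_zero k (by omega))
      (hiter.g_ne_zero k (by omega))
    have hH := hiter.integral k (by omega)
    have hT := isDarbouxMatrix_oneFold hΩ hsol.smooth_q hsol.smooth_r hh
      (hiter.smooth_sH k (by omega)) (hiter.smooth_sh k (by omega)) hH (hiter.sq_sh k (by omega))
    -- The data of stage `k + 1` unfold definitionally to `nextQ`, `nextR` and the image under the
    -- one-fold matrix.
    exact ⟨hsol.next hΩ hh hH, hT.mul hΩ hdar, fun j hj => hT.isEigenfunction hΩ (hef j hj)⟩

/-- The ratio generating the step `k + 1` is an integral of the potentials at that stage. -/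
lemma IsIteration.isIntegral_ratio (hΩ : IsOpen Ω) (hseed : IsSolution Ω S.q S.r)
    (heig : ∀ j < n, IsEigenfunction Ω S.q S.r (lam j) (S.f j) (S.g j))
    (hiter : IsIteration Ω p₀ S lam sH sh n) {k : ℕ} (hk : k < n) :
    IsIntegral Ω (stage S lam sH sh (k + 1)).q (stage S lam sH sh (k + 1)).r
      ((stage S lam sH sh k).h k) := by
  obtain ⟨hsol, -, hef⟩ := hiter.stage_spec hΩ hseed heig hk.le
  exact ((hef k hk).isRatio hΩ (hiter.f_ne_zero k hk) (hiter.g_ne_zero k hk)).isIntegral_next hΩ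
    hsol.smooth_q hsol.smooth_r (hiter.integral k hk)

lemma IsIteration.sH_succ_sq (hΩ : IsOpen Ω) (hΩc : IsPreconnected Ω) (hp₀ : p₀ ∈ Ω)
    (hseed : IsSolution Ω S.q S.r)
    (heig : ∀ j < n, IsEigenfunction Ω S.q S.r (lam j) (S.f j) (S.g j))
    (hiter : IsIteration Ω p₀ S lam sH sh n) {k : ℕ} (hk : k + 1 < n) (hp : p ∈ Ω) :
    sH (k + 1) p ^ 2 = (stage S lam sH sh k).h k p :=
  (hiter.integral (k + 1) hk).eqOn hΩ hΩc
    (hiter.isIntegral_ratio hΩ hseed heig (by omega)) hp₀ (hiter.normalized k hk) hp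

lemma smoothOn_det {n : ℕ} {A : ℝ × ℝ → Matrix (Fin n) (Fin n) ℂ}
    (hA : ∀ i j, SmoothOn Ω fun p => A p i j) : SmoothOn Ω fun p => (A p).det := by
  simp only [det_apply']
  exact ContDiffOn.sum fun σ _ => contDiffOn_const.mul (contDiffOn_prod fun i _ => hA _ _)

lemma smoothOn_det_What (hf : ∀ j < n, SmoothOn Ω (S.f j)) (hg : ∀ j < n, SmoothOn Ω (S.g j)) :
    SmoothOn Ω fun p => (What n lam S p).det := by
  refine smoothOn_det fun i j => ?_
  simp only [What, vand_apply]
  exact ((smoothOn_const _).mul (hg i i.2)).add ((smoothOn_const _).mul (hf i i.2))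

lemma smoothOn_leadCoeff (hs : ∀ k < n, SmoothOn Ω (sH k)) (hm : ∀ k < n, SmoothOn Ω (sh k))
    (hm0 : ∀ k < n, ∀ p ∈ Ω, sh k p ≠ 0) : SmoothOn Ω (leadCoeff sH sh n) :=
  contDiffOn_prod fun k hk => (hs k (Finset.mem_range.1 hk)).div (hm k (Finset.mem_range.1 hk))
    (hm0 k (Finset.mem_range.1 hk))

end CoupledDNLSII

end

/-! ### Assembly of the theorem. -/

open CoupledDNLSII in
theorem theorem4 (n : ℕ) (hn : 1 ≤ n)
    (Ω : Set (ℝ × ℝ)) (hΩ : IsOpen Ω) (hΩc : IsPreconnected Ω)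
    (p₀ : ℝ × ℝ) (hp₀ : p₀ ∈ Ω)
    -- the seed solution with its eigenvalues and eigenfunctions
    (S : CoupledDNLSII.Stage) (lam : ℕ → ℂ)
    (hseed : CoupledDNLSII.IsSolution Ω S.q S.r)
    (hlam_ne : ∀ j < n, lam j ≠ 0)
    (hlam_inj : ∀ i < n, ∀ j < n, lam i = lam j → i = j)
    (heig : ∀ j < n, CoupledDNLSII.IsEigenfunction Ω S.q S.r (lam j) (S.f j) (S.g j))
    -- the iteration of the one-fold transformation
    (sH sh : ℕ → ℝ × ℝ → ℂ)
    (hiter : CoupledDNLSII.IsIteration Ω p₀ S lam sH sh n) :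
    -- the iterate is a Darboux transformation to a new solution
    CoupledDNLSII.IsSolution Ω (CoupledDNLSII.stage S lam sH sh n).q
        (CoupledDNLSII.stage S lam sH sh n).r ∧
    CoupledDNLSII.IsDarbouxMatrix Ω S.q S.r (CoupledDNLSII.stage S lam sH sh n).q
        (CoupledDNLSII.stage S lam sH sh n).r (CoupledDNLSII.nFold lam sH sh n) ∧
    -- every integral beyond the one of the seed is a ratio of eigenfunctions
    (∀ k, k + 1 < n → ∀ p ∈ Ω,
        sH (k + 1) p ^ 2 = (CoupledDNLSII.stage S lam sH sh k).h k p) ∧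
    CoupledDNLSII.IsIntegral Ω (CoupledDNLSII.stage S lam sH sh n).q
        (CoupledDNLSII.stage S lam sH sh n).r
        ((CoupledDNLSII.stage S lam sH sh (n - 1)).h (n - 1)) ∧
    -- the determinant representation
    (∀ p ∈ Ω, (CoupledDNLSII.W n lam S p).det ≠ 0 ∧
        (CoupledDNLSII.What n lam S p).det ≠ 0) ∧
    ∃ D : ℝ × ℝ → ℂ, CoupledDNLSII.SmoothOn Ω D ∧
      (∀ p ∈ Ω, D p ^ 2 =
        (CoupledDNLSII.W n lam S p).det * (CoupledDNLSII.What n lam S p).det) ∧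
      ∀ p ∈ Ω, ∀ z : ℂ, CoupledDNLSII.nFold lam sH sh n z p =
        CoupledDNLSII.detFormula n lam S (sH 0 p) (D p) z p := by
  have hs0 : ∀ k < n, ∀ p ∈ Ω, sH k p ≠ 0 := fun k hk p hp =>
    ne_zero_of_sq_eq rfl ((hiter.integral k hk).ne_zero p hp)
  have hm0 : ∀ k < n, ∀ p ∈ Ω, sh k p ≠ 0 := fun k hk p hp =>
    ne_zero_of_sq_eq (hiter.sq_sh k hk p hp)
      (div_ne_zero (hiter.f_ne_zero k hk p hp) (hiter.g_ne_zero k hk p hp))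
  have hH : ∀ k, k + 1 < n → ∀ p ∈ Ω, sH (k + 1) p ^ 2 = (stage S lam sH sh k).h k p :=
    fun k hk p hp => hiter.sH_succ_sq hΩ hΩc hp₀ hseed heig hk hp
  have hdet := fun p (hp : p ∈ Ω) => leadCoeff_sq_mul_det (p := p) (fun k hk => hs0 k hk p hp)
    (fun k hk => hm0 k hk p hp) (fun k hk => hiter.f_ne_zero k hk p hp)
    (fun k hk => hiter.g_ne_zero k hk p hp) (fun k hk => hiter.sq_sh k hk p hp)
    (fun k hk => (hH k hk p hp).trans (hiter.sq_sh k (by omega) p hp).symm) le_rfl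
  obtain ⟨hsol, hdar, -⟩ := hiter.stage_spec hΩ hseed heig le_rfl
  refine ⟨hsol, hdar, hH, ?_, fun p hp => ⟨(hdet p hp).1, (hdet p hp).2.1⟩, ?_⟩
  · have := hiter.isIntegral_ratio hΩ hseed heig (show n - 1 < n by omega)
    rwa [Nat.sub_add_cancel hn] at this
  have ha0 : ∀ p ∈ Ω, leadCoeff sH sh n p ≠ 0 := fun p hp =>
    leadCoeff_ne_zero (fun k hk => hs0 k hk p hp) (fun k hk => hm0 k hk p hp)
  have hT : ∀ p ∈ Ω, ∀ z, That n lam S z p =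
      Matrix.diagonal ![(What n lam S p).det / leadCoeff sH sh n p,
        (W n lam S p).det * leadCoeff sH sh n p] * nFold lam sH sh n z p := fun p hp =>
    That_eq (fun k hk => hs0 k hk p hp) (fun k hk => hm0 k hk p hp) fun j hj =>
      nFold_mulVec_eq_zero (fun k hk => hm0 k hk p hp) (fun k hk => hiter.g_ne_zero k hk p hp)
        (fun k hk => hiter.sq_sh k hk p hp) hj
  -- The branch is explicit, `|Ŵ_n| / a` times `√H` for odd `n`. It is smooth as a quotient of
  -- smooth functions, and its square is `|W_n| |Ŵ_n|` by the relation for `a²`.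
  refine ⟨fun p => (if Even n then 1 else sH 0 p) * ((What n lam S p).det / leadCoeff sH sh n p),
    SmoothOn.mul ?_ ((smoothOn_det_What (fun j hj => (heig j hj).smooth_f)
      fun j hj => (heig j hj).smooth_g).div
        (smoothOn_leadCoeff hiter.smooth_sH hiter.smooth_sh hm0) ha0), fun p hp => ?_,
    fun p hp z => ?_⟩
  · split_ifs
    exacts [smoothOn_const 1, hiter.smooth_sH 0 hn]
  · have a0 := ha0 p hp
    obtain ⟨-, -, h⟩ := hdet p hp
    by_cases hev : Even n
    · simp only [hev, if_true] at h ⊢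
      field_simp
      linear_combination -(What n lam S p).det * h
    · simp only [hev, if_false] at h ⊢
      field_simp
      linear_combination -(What n lam S p).det * h
  · have a0 := ha0 p hp
    have s0 := hs0 0 hn p hp
    obtain ⟨h1, h2, h⟩ := hdet p hp
    rw [detFormula, hT p hp z]
    by_cases hev : Even n
    · simp only [hev, if_true] at h ⊢
      have : (W n lam S p).det * leadCoeff sH sh n p
          = (What n lam S p).det / leadCoeff sH sh n p := by
        field_simp
        linear_combination h
      rw [this]
      ext i j
      fin_cases i <;> simp [Matrix.diagonal_mul] <;> field_simp
    · simp only [hev, if_false] at h ⊢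
      -- For odd `n` the factor `diag(|Ŵ_n| / a, |W_n| a)` equals `D · diag(1/√H, √H)`, and the
      -- diagonal prefactor in the formula undoes it.
      have : (W n lam S p).det * leadCoeff sH sh n p
          = sH 0 p ^ 2 * ((What n lam S p).det / leadCoeff sH sh n p) := by
        field_simp
        linear_combination h
      rw [this]
      ext i j
      fin_cases i <;> simp [Matrix.diagonal_mul] <;> field_simp
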